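/- Let $G$ be a group. A \emph{configuration pair} of $G$ consists of a finite tuple $\mathfrak g=(g_1,\dots,g_n)$ of elements generating $G$ and a partition $\mathcal E=\{E_1,\dots,E_m\}$ of $G$ into finitely many nonempty blocks. Its set of two-sided configurations $\operatorname{Con}_t(\mathfrak g,\mathcal E)$ is the set of all tuples $(c_0,c_1,\dots,c_{2n})\in\{1,\dots,m\}^{2n+1}$ for which there is $x\in E_{c_0}$ with $g_ix\in E_{c_i}$ and $xg_i\in E_{c_{i+n}}$ for every $i\in\{1,\dots,n\}$. Let $\operatorname{Con}_t(G)$ be the collection of the sets $\operatorname{Con}_t(\mathfrak g,\mathcal E)$ over all configuration pairs of $G$. Groups $G$ and $H$ are \emph{two-sided configuration equivalent}, written $G\approx_t H$, if $\operatorname{Con}_t(G)=\operatorname{Con}_t(H)$. Let $\mathbf P(G)$ denote the set of normal subgroups $N$ of $G$ such that $G/N$ is polycyclic (i.e. has a finite subnormal series with cyclic factors). Let $G$ and $H$ be finitely generated groups with $G\approx_t H$. Then $\mathbf P(G)$ and $\mathbf P(H)$ have the same cardinality. Furthermore, if $\mathbf P(G)$ is finite, then there is a bijection $\Psi:\mathbf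 P(G)\to\mathbf P(H)$ such that (1) for all $N,M\in\mathbf P(G)$ one has $N\cap M\in\mathbf P(G)$ and $\Psi(N\cap M)=\Psi(N)\cap\Psi(M)$; (2) for every $N\in\mathbf P(G)$, $G/N\cong H/\Psi(N)$. -/

import Mathlib

/-- A configuration pair `(𝔤, ℰ)` of a group `G`: an ordered generating set `𝔤 = (g₁, …, gₙ)` and a
partition `ℰ = {E₁, …, Eₘ}` of `G` into `m` nonempty blocks. The partition is given as a colouring
of `G` by `m` colours in which every colour occurs; the block `E c` is the set of elements of
colour `c`. -/
structure ConfigurationPair (G : Type*) [Group G] (n m : ℕ) where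
  /-- the ordered generating set -/
  gen : Fin n → G
  closure_range_gen : Subgroup.closure (Set.range gen) = ⊤
  /-- the colouring whose colour classes are the blocks of the partition -/
  color : G → Fin m
  color_surjective : Function.Surjective color

namespace ConfigurationPair

variable {G : Type*} [Group G] {n m : ℕ}

/-- The block of colour `c` of the partition. -/
def block (p : ConfigurationPair G n m) (c : Fin m) : Set G := p.color ⁻¹' {c}

/-- The set `Con_t(𝔤, ℰ)` of two-sided configurations: the tuples `(c₀, c₁, …, c₂ₙ)` of colours for
which there is `x ∈ E_{c₀}` with `gᵢ x ∈ E_{cᵢ}` and `x gᵢ ∈ E_{c_{i+n}}` for `i = 1, …, n`.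
The generators are numbered from `0` here, so `p.gen i` is the generator with number `i + 1`. -/
def twoSidedConfigurations (p : ConfigurationPair G n m) : Set (Fin (2 * n + 1) → Fin m) :=
  {C | ∃ x ∈ p.block (C 0), ∀ i : Fin n,
    p.gen i * x ∈ p.block (C ⟨i + 1, by omega⟩) ∧
    x * p.gen i ∈ p.block (C ⟨i + 1 + n, by omega⟩)}

end ConfigurationPair

/-- The part of `Con_t(G)` that comes from configuration pairs with `n` generators and `m` blocks.
(Both numbers can be read off from a set of two-sided configurations, so that `Con_t(G)` is
the disjoint union of these parts.) -/
def twoSidedConfigurationSets (G : Type*) [Group G] (n m : ℕ) :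
    Set (Set (Fin (2 * n + 1) → Fin m)) :=
  {S | ∃ p : ConfigurationPair G n m, p.twoSidedConfigurations = S}

/-- Two-sided configuration equivalence `G ≈ₜ H`: `Con_t(G) = Con_t(H)`. -/
def TwoSidedConfigurationEquivalent (G H : Type*) [Group G] [Group H] : Prop :=
  ∀ n m : ℕ, twoSidedConfigurationSets G n m = twoSidedConfigurationSets H n m

/-- A group is polycyclic if it has a subnormal series from `1` to the whole group
all of whose factors are cyclic. -/
def IsPolycyclicGroup (Q : Type*) [Group Q] : Prop :=
  ∃ (k : ℕ) (s : Fin (k + 1) → Subgroup Q), s 0 = ⊥ ∧ s (Fin.last k) = ⊤ ∧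
    ∀ i : Fin k, s i.castSucc ≤ s i.succ ∧
      ∃ _ : ((s i.castSucc).subgroupOf (s i.succ)).Normal,
        IsCyclic (s i.succ ⧸ (s i.castSucc).subgroupOf (s i.succ))

/-- `P(G)`: the normal subgroups of `G` with polycyclic quotient. -/
def polycyclicQuotientSubgroups (G : Type*) [Group G] : Set (Subgroup G) :=
  {N | ∃ _ : N.Normal, IsPolycyclicGroup (G ⧸ N)}

instance polycyclicQuotientSubgroups.normal {G : Type*} [Group G]
    (N : polycyclicQuotientSubgroups G) : (N : Subgroup G).Normal :=
  N.2.fst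

/-!
The theorem reduces to finite quotients, together with a countability statement.

*Finite quotients transfer.* Let `N` be a normal subgroup of finite index in `G`. Colour `G` by the
elements of `G ⧸ N`. The configurations then record that left multiplication by a generator acts on
the colours as left multiplication by its class. A configuration pair of `H` with the same
configurations obeys the same rule, so `H` acts on the colours by left translations, which gives a
surjection `H → G ⧸ N` (`TwoSidedConfigurationEquivalent.exists_surjective_quotient`).

*Finiteness of `P(G)` is visible on finite quotients.* An infinite polycyclic group has an infinite
cyclic factor in its series, hence finite quotients of unbounded order
(`exists_index_gt_of_mem_polycyclicQuotientSubgroups`). So `P(G)` is finite if and only if its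
members of finite index have bounded index. In this case, as `P(G)` is closed under
intersections, it has a least member `N₀`, whose index is finite
(`exists_least_polycyclicQuotientSubgroup`). Boundedness passes between `G` and `H` by the
transfer of finite quotients, so `P(G)` is finite if and only if `P(H)` is.

*The finite case.* The groups `G ⧸ N₀` and `H ⧸ M₀` are quotients of each other and finite, so they
are isomorphic, and `P(G)` and `P(H)` both correspond to the normal subgroups of this common group
(`polycyclicQuotientSubgroupsEquiv`).

*The infinite case.* Polycyclic groups are finitely presented
(`IsPolycyclicGroup.isFinitelyPresented`), so `P(G)` and `P(H)` are countable
(`countable_polycyclicQuotientSubgroups`), and both are countably infinite.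
-/

open Relation

/-! ### Subnormal series with cyclic factors -/

/-- `S` is normal in `T` with cyclic quotient `T / S`. -/
def IsCyclicStep {G : Type*} [Group G] (S T : Subgroup G) : Prop :=
  S ≤ T ∧ ∃ _ : (S.subgroupOf T).Normal, IsCyclic (T ⧸ S.subgroupOf T)

section Series

variable {G G' : Type*} [Group G] [Group G']

theorem IsCyclicStep.of_ker {S T : Subgroup G} {C : Type*} [Group C] [IsCyclic C] (hST : S ≤ T)
    (χ : T →* C) (hχ : χ.ker = S.subgroupOf T) : IsCyclicStep S T := by
  refine ⟨hST, ?_⟩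
  rw [← hχ]
  exact ⟨inferInstance,
    isCyclic_of_injective (QuotientGroup.kerLift χ) (QuotientGroup.kerLift_injective χ)⟩

theorem IsCyclicStep.comap {S T : Subgroup G'} (h : IsCyclicStep S T) (f : G →* G') :
    IsCyclicStep (S.comap f) (T.comap f) := by
  obtain ⟨hST, _, _⟩ := h
  refine .of_ker (Subgroup.comap_mono hST)
    ((QuotientGroup.mk' (S.subgroupOf T)).comp (f.subgroupComap T)) ?_
  ext x
  simp only [MonoidHom.mem_ker, MonoidHom.comp_apply, QuotientGroup.mk'_apply,
    QuotientGroup.eq_one_iff, Subgroup.mem_subgroupOf]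
  rfl

theorem IsCyclicStep.inf_right {S T : Subgroup G} (h : IsCyclicStep S T) (U : Subgroup G) :
    IsCyclicStep (S ⊓ U) (T ⊓ U) := by
  obtain ⟨hST, _, _⟩ := h
  refine .of_ker (inf_le_inf_right U hST)
    ((QuotientGroup.mk' (S.subgroupOf T)).comp (Subgroup.inclusion inf_le_left)) ?_
  ext x
  have hx : (x : G) ∈ U := x.2.2
  simp [MonoidHom.mem_ker, Subgroup.mem_subgroupOf, hx]

theorem IsCyclicStep.map {S T : Subgroup G} (h : IsCyclicStep S T) (f : G →* G') :
    IsCyclicStep (S.map f) (T.map f) := by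
  obtain ⟨hST, hn, _⟩ := h
  have hS : (S.map f).subgroupOf (T.map f) = (S.subgroupOf T).map (f.subgroupMap T) := by
    ext ⟨x, hx⟩
    simp only [Subgroup.mem_subgroupOf, Subgroup.mem_map]
    constructor
    · rintro ⟨y, hy, rfl⟩
      exact ⟨⟨y, hST hy⟩, hy, rfl⟩
    · rintro ⟨y, hy, hyx⟩
      exact ⟨y, hy, congrArg Subtype.val hyx⟩
  have hn' : ((S.map f).subgroupOf (T.map f)).Normal :=
    hS ▸ hn.map _ (f.subgroupMap_surjective T)
  refine ⟨Subgroup.map_mono hST, hn', ?_⟩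
  exact isCyclic_of_surjective
    (QuotientGroup.map (S.subgroupOf T) _ (f.subgroupMap T)
      (by rw [hS]; exact Subgroup.le_comap_map _ _))
    (QuotientGroup.map_surjective_of_surjective _ _ _
      (QuotientGroup.mk_surjective.comp (f.subgroupMap_surjective T)) _)

/-- Passing from the indexed subnormal series to the reflexive transitive closure of
`IsCyclicStep` loses only the length of the series. -/
theorem isPolycyclicGroup_iff :
    IsPolycyclicGroup G ↔ ReflTransGen IsCyclicStep (⊥ : Subgroup G) ⊤ := by
  constructor
  · rintro ⟨k, s, h0, hk, hs⟩
    have key : ∀ i, ReflTransGen IsCyclicStep (s 0) (s i) := fun i ↦ by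
      induction i using Fin.induction with
      | zero => exact .refl
      | succ i ih => exact ih.tail (hs i)
    simpa [h0, hk] using key (Fin.last k)
  · suffices ∀ T : Subgroup G, ReflTransGen IsCyclicStep ⊥ T →
        ∃ (k : ℕ) (s : Fin (k + 1) → Subgroup G), s 0 = ⊥ ∧ s (Fin.last k) = T ∧
          ∀ i : Fin k, IsCyclicStep (s i.castSucc) (s i.succ) from fun h ↦ this ⊤ h
    intro T hT
    induction hT with
    | refl => exact ⟨0, fun _ ↦ ⊥, rfl, rfl, fun i ↦ i.elim0⟩
    | @tail S T _ hST ih =>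
      obtain ⟨k, s, h0, hk, hs⟩ := ih
      refine ⟨k + 1, Fin.snoc s T, ?_, Fin.snoc_last _ _, fun i ↦ ?_⟩
      · rw [← Fin.castSucc_zero, Fin.snoc_castSucc, h0]
      · induction i using Fin.lastCases with
        | last => rw [Fin.snoc_castSucc, hk, Fin.succ_last, Fin.snoc_last]; exact hST
        | cast i => rw [Fin.snoc_castSucc, Fin.succ_castSucc, Fin.snoc_castSucc]; exact hs i

theorem mem_polycyclicQuotientSubgroups_iff {N : Subgroup G} :
    N ∈ polycyclicQuotientSubgroups G ↔ N.Normal ∧ ReflTransGen IsCyclicStep N ⊤ := by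
  constructor
  · rintro ⟨hN, h⟩
    refine ⟨hN, ?_⟩
    simpa [Function.onFun] using
      (isPolycyclicGroup_iff.1 h).lift (Subgroup.comap (QuotientGroup.mk' N))
        fun _ _ h ↦ h.comap _
  · rintro ⟨hN, h⟩
    refine ⟨hN, isPolycyclicGroup_iff.2 ?_⟩
    simpa [Function.onFun, Subgroup.map_top_of_surjective _ (QuotientGroup.mk'_surjective N)] using
      h.lift (Subgroup.map (QuotientGroup.mk' N)) fun _ _ h ↦ h.map _

theorem inf_mem_polycyclicQuotientSubgroups {N M : Subgroup G}
    (hN : N ∈ polycyclicQuotientSubgroups G) (hM : M ∈ polycyclicQuotientSubgroups G) :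
    N ⊓ M ∈ polycyclicQuotientSubgroups G := by
  rw [mem_polycyclicQuotientSubgroups_iff] at *
  obtain ⟨hN, hN'⟩ := hN
  obtain ⟨hM, hM'⟩ := hM
  refine ⟨inferInstance, .trans ?_ hM'⟩
  simpa [Function.onFun] using hN'.lift (· ⊓ M) fun _ _ h ↦ h.inf_right M

theorem map_mem_polycyclicQuotientSubgroups {f : G →* G'} (hf : Function.Surjective f)
    {N : Subgroup G} (hN : N ∈ polycyclicQuotientSubgroups G) :
    N.map f ∈ polycyclicQuotientSubgroups G' := by
  rw [mem_polycyclicQuotientSubgroups_iff] at *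
  refine ⟨hN.1.map f hf, ?_⟩
  simpa [Function.onFun, Subgroup.map_top_of_surjective f hf] using
    hN.2.lift (Subgroup.map f) fun _ _ h ↦ h.map f

theorem comap_mem_polycyclicQuotientSubgroups (f : G →* G') {N : Subgroup G'}
    (hN : N ∈ polycyclicQuotientSubgroups G') : N.comap f ∈ polycyclicQuotientSubgroups G := by
  rw [mem_polycyclicQuotientSubgroups_iff] at *
  refine ⟨hN.1.comap f, ?_⟩
  simpa [Function.onFun] using hN.2.lift (Subgroup.comap f) fun _ _ h ↦ h.comap f

theorem mem_polycyclicQuotientSubgroups_of_le {N M : Subgroup G} [M.Normal]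
    (hN : N ∈ polycyclicQuotientSubgroups G) (hNM : N ≤ M) :
    M ∈ polycyclicQuotientSubgroups G := by
  have := comap_mem_polycyclicQuotientSubgroups (QuotientGroup.mk' M)
    (map_mem_polycyclicQuotientSubgroups (QuotientGroup.mk'_surjective M) hN)
  rwa [Subgroup.comap_map_eq, QuotientGroup.ker_mk', sup_eq_right.2 hNM] at this

theorem top_mem_polycyclicQuotientSubgroups : ⊤ ∈ polycyclicQuotientSubgroups G :=
  mem_polycyclicQuotientSubgroups_iff.2 ⟨inferInstance, .refl⟩

end Series

/-! ### Finite polycyclic quotients and finiteness of `P(G)` -/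

section FiniteQuotients

variable {G : Type*} [Group G]

/-- A subnormal series with cyclic factors and infinite total index has an infinite cyclic factor,
and the subgroups of finite index in that factor give intermediate subgroups of finite index. -/
theorem exists_relIndex_gt_of_reflTransGen {N T : Subgroup G} (h : ReflTransGen IsCyclicStep N T)
    (hNT : N.relIndex T = 0) (B : ℕ) :
    ∃ U, N ≤ U ∧ U ≤ T ∧ U.relIndex T ≠ 0 ∧ B < U.relIndex T := by
  have le_of : ∀ {S}, ReflTransGen IsCyclicStep N S → N ≤ S := fun h ↦ by
    induction h with
    | refl => exact le_rfl
    | tail _ h ih => exact ih.trans h.1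
  induction h with
  | refl => simp at hNT
  | @tail S T hNS hST ih =>
    by_cases hS : S.relIndex T = 0
    · obtain ⟨hle, _, _⟩ := hST
      have : Infinite (T ⧸ S.subgroupOf T) := Nat.card_eq_zero.1 hS |>.resolve_left
        fun h ↦ h.elim (QuotientGroup.mk 1)
      let e : Multiplicative ℤ ≃* T ⧸ S.subgroupOf T := intCyclicMulEquiv
      let χ : T →* Multiplicative ℤ := e.symm.toMonoidHom.comp (QuotientGroup.mk' _)
      have hχ : Function.Surjective χ := e.symm.surjective.comp (QuotientGroup.mk'_surjective _)
      let Z : Subgroup (Multiplicative ℤ) :=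
        AddSubgroup.toSubgroup (AddSubgroup.zmultiples ((B + 1 : ℕ) : ℤ))
      have hZ : Z.index = B + 1 := Int.index_zmultiples ((B + 1 : ℕ) : ℤ)
      have hU : ((Z.comap χ).map T.subtype).relIndex T = B + 1 := by
        rw [Subgroup.relIndex, Subgroup.subgroupOf, Subgroup.comap_map_eq_self_of_injective
          T.subtype_injective, Subgroup.index_comap_of_surjective _ hχ, hZ]
      refine ⟨(Z.comap χ).map T.subtype, (le_of hNS).trans fun x hx ↦ ?_,
        Subgroup.map_subtype_le _, by omega, by omega⟩
      refine ⟨⟨x, hle hx⟩, ?_, rfl⟩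
      have : χ ⟨x, hle hx⟩ = 1 := by
        simpa [χ, Subgroup.mem_subgroupOf] using hx
      simp [this, Z.one_mem]
    · have hN : N.relIndex S = 0 := by
        rw [← Subgroup.relIndex_mul_relIndex N S T (le_of hNS) hST.1] at hNT
        exact (mul_eq_zero.1 hNT).resolve_right hS
      obtain ⟨U, hNU, hUS, hU0, hUB⟩ := ih hN
      refine ⟨U, hNU, hUS.trans hST.1, ?_⟩
      rw [← Subgroup.relIndex_mul_relIndex U S T hUS hST.1]
      exact ⟨mul_ne_zero hU0 hS, hUB.trans_le (Nat.le_mul_of_pos_right _ (Nat.pos_of_ne_zero hS))⟩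

theorem exists_index_gt_of_mem_polycyclicQuotientSubgroups {N : Subgroup G}
    (hN : N ∈ polycyclicQuotientSubgroups G) (hN0 : N.index = 0) (B : ℕ) :
    ∃ M ∈ polycyclicQuotientSubgroups G, M.FiniteIndex ∧ B < M.index := by
  obtain ⟨hn, h⟩ := mem_polycyclicQuotientSubgroups_iff.1 hN
  obtain ⟨U, hNU, -, hU0, hUB⟩ := exists_relIndex_gt_of_reflTransGen h (by simpa using hN0) B
  rw [Subgroup.relIndex_top_right] at hU0 hUB
  have : U.FiniteIndex := ⟨hU0⟩
  exact ⟨U.normalCore,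
    mem_polycyclicQuotientSubgroups_of_le hN (Subgroup.normal_le_normalCore.2 hNU), inferInstance,
    hUB.trans_le (Subgroup.index_antitone U.normalCore_le)⟩

variable (G) in
/-- Members of infinite index satisfy the bound trivially, their `index` being `0`. -/
theorem exists_index_le_of_finite_polycyclicQuotientSubgroups
    (h : (polycyclicQuotientSubgroups G).Finite) :
    ∃ B : ℕ, ∀ N ∈ polycyclicQuotientSubgroups G, N.index ≤ B := by
  obtain ⟨B, hB⟩ := (h.image Subgroup.index).bddAbove
  exact ⟨B, fun N hN ↦ hB ⟨N, hN, rfl⟩⟩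

/-- If the finite polycyclic quotients of `G` have bounded order, there is a largest one, and
it is the largest polycyclic quotient. -/
theorem exists_least_polycyclicQuotientSubgroup {B : ℕ}
    (hB : ∀ N ∈ polycyclicQuotientSubgroups G, N.FiniteIndex → N.index ≤ B) :
    ∃ N₀ : Subgroup G, IsLeast (polycyclicQuotientSubgroups G) N₀ ∧ N₀.FiniteIndex := by
  have hfin : ∀ N ∈ polycyclicQuotientSubgroups G, N.FiniteIndex := fun N hN ↦ by
    refine ⟨fun h0 ↦ ?_⟩
    obtain ⟨M, hM, hMf, hlt⟩ := exists_index_gt_of_mem_polycyclicQuotientSubgroups hN h0 B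
    exact (hB M hM hMf).not_gt hlt
  -- a member of largest index lies below each other member, since it equals their intersection
  have hbdd : BddAbove (Subgroup.index '' polycyclicQuotientSubgroups G) :=
    ⟨B, by rintro _ ⟨N, hN, rfl⟩; exact hB N hN (hfin N hN)⟩
  obtain ⟨N₀, h₀, hmax⟩ := Nat.sSup_mem
    (Set.Nonempty.image _ ⟨⊤, top_mem_polycyclicQuotientSubgroups⟩) hbdd
  refine ⟨N₀, ⟨h₀, fun N hN ↦ ?_⟩, hfin _ h₀⟩
  have hinf := inf_mem_polycyclicQuotientSubgroups h₀ hN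
  have := hfin _ hinf
  by_contra hle
  exact (hmax ▸ le_csSup hbdd ⟨_, hinf, rfl⟩ : (N₀ ⊓ N).index ≤ N₀.index).not_gt
    (Subgroup.index_strictAnti (inf_lt_left.2 hle))

theorem finite_polycyclicQuotientSubgroups_of_isLeast {N₀ : Subgroup G}
    (h : IsLeast (polycyclicQuotientSubgroups G) N₀) [N₀.FiniteIndex] :
    (polycyclicQuotientSubgroups G).Finite := by
  have hn : N₀.Normal := (mem_polycyclicQuotientSubgroups_iff.1 h.1).1
  have : Finite (G ⧸ N₀) := inferInstance
  refine (Set.finite_range (Subgroup.comap (QuotientGroup.mk' N₀))).subset fun N hN ↦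
    ⟨N.map (QuotientGroup.mk' N₀), ?_⟩
  rw [Subgroup.comap_map_eq, QuotientGroup.ker_mk', sup_eq_left.2 (h.2 hN)]

end FiniteQuotients

/-! ### Polycyclic groups are finitely presented -/

section FinitePresentation

variable {G Q : Type*} [Group G] [Group Q]

open Monoid.Coprod in
/-- A cyclic extension of a finitely presented group `K` is the quotient of the free product
`K ∗ ℤ` by finitely many relations: those giving the conjugation action of a lift `t` of a
generator on generators of `K`, and one identifying `t ^ a` with an element of `K`,
where `a` generates the group of exponents `j` with `t ^ j ∈ K` (so `a = 0` if `Q ⧸ K` is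
infinite). -/
theorem Group.IsFinitelyPresented.of_isCyclic_quotient (K : Subgroup Q) [K.Normal]
    [Group.IsFinitelyPresented K] [IsCyclic (Q ⧸ K)] : Group.IsFinitelyPresented Q := by
  obtain ⟨g, hg⟩ := IsCyclic.exists_generator (α := Q ⧸ K)
  obtain ⟨t, rfl⟩ := QuotientGroup.mk_surjective g
  have ht : ∀ q : Q, ∃ k : K, ∃ j : ℤ, q = k * t ^ j := fun q ↦ by
    obtain ⟨j, hj⟩ := hg q
    have hj : ((t ^ j : Q) : Q ⧸ K) = q := hj
    exact ⟨⟨q * (t ^ j)⁻¹, by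
      rw [← QuotientGroup.eq_one_iff]; simp [← hj]⟩, j, by simp⟩
  have : Group.FG K := by
    obtain ⟨n, φ, hφ, -⟩ := ‹Group.IsFinitelyPresented K›
    exact Group.fg_of_surjective hφ
  obtain ⟨S, hS, hSfin⟩ := Group.fg_iff.1 this
  obtain ⟨a, ha⟩ := Int.subgroup_cyclic
    (Subgroup.toAddSubgroup (K.comap (zpowersHom Q t)) : AddSubgroup ℤ)
  have ha : ∀ j : ℤ, t ^ j ∈ K ↔ ∃ i : ℤ, i * a = j := fun j ↦ by
    have := SetLike.ext_iff.1 ha j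
    rw [AddSubgroup.mem_closure_singleton] at this
    simp only [smul_eq_mul] at this
    exact Iff.trans Iff.rfl this
  have hta : t ^ a ∈ K := (ha a).2 ⟨1, one_mul a⟩
  let f : Monoid.Coprod K (Multiplicative ℤ) →* Q := lift K.subtype (zpowersHom Q t)
  let τ : Monoid.Coprod K (Multiplicative ℤ) := inr (Multiplicative.ofAdd 1)
  have hfl : ∀ k : K, f (inl k) = k := fun k ↦ by simp [f]
  have hfτ : f τ = t := by simp [f, τ]
  have hinr : ∀ j : Multiplicative ℤ, (inr j : Monoid.Coprod K (Multiplicative ℤ)) =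
      τ ^ (Multiplicative.toAdd j) := fun j ↦ by
    rw [← map_zpow, ← ofAdd_zsmul]; simp
  let R : Set (Monoid.Coprod K (Multiplicative ℤ)) :=
    (fun s : K ↦ τ * inl s * τ⁻¹ * (inl (MulAut.conjNormal t s))⁻¹) '' S ∪
      {τ ^ a * (inl ⟨t ^ a, hta⟩)⁻¹}
  refine .of_surjective f (fun q ↦ ?_) ⟨R, (hSfin.image _).union (Set.finite_singleton _), ?_⟩
  · obtain ⟨k, j, rfl⟩ := ht q
    exact ⟨inl k * τ ^ j, by rw [map_mul, map_zpow, hfl, hfτ]⟩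
  have hker : Subgroup.normalClosure R ≤ f.ker := by
    refine Subgroup.normalClosure_le_normal ?_
    rintro _ (⟨s, -, rfl⟩ | rfl) <;> simp [MonoidHom.mem_ker, hfl, hfτ]
  let π := QuotientGroup.mk' (Subgroup.normalClosure R)
  have hR : ∀ r ∈ R, π r = 1 := fun r hr ↦
    (QuotientGroup.eq_one_iff r).2 (Subgroup.subset_normalClosure hr)
  have hconj : ∀ k : K, π τ * π (inl k) * (π τ)⁻¹ = π (inl (MulAut.conjNormal t k)) := by
    have : ((MulAut.conj (π τ)).toMonoidHom.comp (π.comp inl) : K →* _) =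
        (π.comp inl).comp (MulAut.conjNormal t : MulAut K).toMonoidHom := by
      refine MonoidHom.eq_of_eqOn_dense hS fun s hs ↦ ?_
      have := hR _ (Or.inl ⟨s, hs, rfl⟩)
      simpa [mul_inv_eq_one] using this
    exact fun k ↦ DFunLike.congr_fun this k
  have hconj' : ∀ k : K, (π τ)⁻¹ * π (inl k) * π τ =
      π (inl ((MulAut.conjNormal t : MulAut K).symm k)) := fun k ↦ by
    have := hconj ((MulAut.conjNormal t : MulAut K).symm k)
    rw [MulEquiv.apply_symm_apply] at this
    rw [← this]; group
  have hpow : π τ ^ a = π (inl ⟨t ^ a, hta⟩) := by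
    have := hR _ (Or.inr rfl)
    simpa [mul_inv_eq_one] using this
  -- conjugation by powers of `τ` preserves the image of `K`, which gives a normal form
  have hconjz : ∀ j : ℤ, ∀ k : K, ∃ k' : K, π τ ^ j * π (inl k) = π (inl k') * π τ ^ j := by
    intro j
    induction j with
    | zero => exact fun k ↦ ⟨k, by simp⟩
    | succ n ih =>
      intro k
      obtain ⟨k', hk'⟩ := ih (MulAut.conjNormal t k)
      refine ⟨k', ?_⟩
      rw [zpow_add_one, ← mul_assoc, ← hk', ← hconj]; group
    | pred n ih =>
      intro k
      obtain ⟨k', hk'⟩ := ih ((MulAut.conjNormal t : MulAut K).symm k)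
      refine ⟨k', ?_⟩
      rw [zpow_sub_one, ← mul_assoc, ← hk', ← hconj']; group
  have hnf : ∀ x, ∃ k : K, ∃ j : ℤ, π x = π (inl k) * π τ ^ j := fun x ↦ by
    induction x using Monoid.Coprod.induction_on' with
    | one => exact ⟨1, 0, by simp⟩
    | inl_mul m x ih =>
      obtain ⟨k, j, h⟩ := ih
      exact ⟨m * k, j, by simp only [map_mul, h, mul_assoc]⟩
    | inr_mul n x ih =>
      obtain ⟨k, j, h⟩ := ih
      obtain ⟨k', hk'⟩ := hconjz (Multiplicative.toAdd n) k
      exact ⟨k', Multiplicative.toAdd n + j, by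
        rw [map_mul, h, hinr, map_zpow, ← mul_assoc, hk', mul_assoc, zpow_add]⟩
  refine le_antisymm hker fun x hx ↦ ?_
  obtain ⟨k, j, h⟩ := hnf x
  have hfx : (k : Q) * t ^ j = 1 := by
    have hmem : x⁻¹ * (inl k * τ ^ j) ∈ f.ker := hker (QuotientGroup.eq.1 (by
      simpa [π] using h))
    rw [MonoidHom.mem_ker, map_mul, map_inv, MonoidHom.mem_ker.1 hx] at hmem
    simpa [hfl, hfτ] using hmem
  obtain ⟨i, rfl⟩ := (ha j).1 (by
    rw [← inv_eq_of_mul_eq_one_right hfx]; exact K.inv_mem k.2)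
  rw [← QuotientGroup.eq_one_iff]
  change π x = 1
  rw [h, mul_comm i a, zpow_mul, hpow, ← map_zpow, ← map_zpow, ← map_mul, ← map_mul]
  have : k * (⟨t ^ a, hta⟩ : K) ^ i = 1 := by
    ext
    simpa [← zpow_mul, mul_comm a i] using hfx
  rw [this, map_one, map_one]

theorem IsCyclicStep.isFinitelyPresented {S T : Subgroup Q} (h : IsCyclicStep S T)
    [Group.IsFinitelyPresented S] : Group.IsFinitelyPresented T := by
  obtain ⟨hST, _, _⟩ := h
  have := Group.IsFinitelyPresented.equiv (Subgroup.subgroupOfEquivOfLe hST).symm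
  exact .of_isCyclic_quotient (S.subgroupOf T)

theorem IsPolycyclicGroup.isFinitelyPresented (h : IsPolycyclicGroup Q) :
    Group.IsFinitelyPresented Q := by
  suffices ∀ T : Subgroup Q, ReflTransGen IsCyclicStep ⊥ T → Group.IsFinitelyPresented T by
    have := this ⊤ (isPolycyclicGroup_iff.1 h)
    exact .equiv Subgroup.topEquiv
  intro T hT
  induction hT with
  | refl => infer_instance
  | tail _ hST _ => exact hST.isFinitelyPresented

theorem MonoidHom.countable_of_fg [Group.FG G] [Countable Q] : Countable (G →* Q) := by
  obtain ⟨S, hS, hSfin⟩ := Group.fg_iff.1 ‹Group.FG G›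
  have : Finite S := hSfin
  refine Function.Injective.countable (f := fun (φ : G →* Q) (s : S) ↦ φ s) fun φ ψ h ↦ ?_
  exact MonoidHom.eq_of_eqOn_dense hS fun s hs ↦ congrFun h ⟨s, hs⟩

/-- There are countably many finite presentations, and a finitely generated group has countably
many homomorphisms to each of the groups presented. -/
theorem countable_polycyclicQuotientSubgroups [Group.FG G] :
    (polycyclicQuotientSubgroups G).Countable := by
  have (n : ℕ) (s : Finset (FreeGroup (Fin n))) :
      Countable (PresentedGroup (s : Set (FreeGroup (Fin n)))) :=
    (PresentedGroup.mk_surjective _).countable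
  have (n : ℕ) (s : Finset (FreeGroup (Fin n))) :
      Countable (G →* PresentedGroup (s : Set (FreeGroup (Fin n)))) := MonoidHom.countable_of_fg
  refine (Set.countable_range fun x : Σ (n : ℕ) (s : Finset (FreeGroup (Fin n))),
    G →* PresentedGroup (s : Set (FreeGroup (Fin n))) ↦ x.2.2.ker).mono ?_
  rintro N ⟨hN, hpoly⟩
  have := hpoly.isFinitelyPresented
  obtain ⟨n, s, hs, ⟨e⟩⟩ := Group.IsFinitelyPresented.exists_mulEquiv_presentedGroup (G := G ⧸ N)
  lift s to Finset (FreeGroup (Fin n)) using hs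
  refine ⟨⟨n, s, e.toMonoidHom.comp (QuotientGroup.mk' N)⟩, ?_⟩
  ext x
  simp

end FinitePresentation

/-! ### Transfer of finite quotients -/

section Configurations

variable {G H : Type*} [Group G] [Group H]

theorem TwoSidedConfigurationEquivalent.symm (h : TwoSidedConfigurationEquivalent G H) :
    TwoSidedConfigurationEquivalent H G := fun n m ↦ (h n m).symm

/-- If a group `G` with generators `gᵢ` is coloured by the elements of a finite quotient `G ⧸ N`,
the colour of `gᵢ x` is `gᵢ` times the colour of `x`. A configuration pair of `H` with the same
configurations has generators `hᵢ` and a colouring of `H` by `G ⧸ N` obeying the same rule.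
Hence left translations of `H` induce left translations of the set of colours. -/
theorem TwoSidedConfigurationEquivalent.exists_surjective_quotient [Group.FG G]
    (h : TwoSidedConfigurationEquivalent G H) (N : Subgroup G) [N.Normal] [N.FiniteIndex] :
    ∃ f : H →* G ⧸ N, Function.Surjective f := by
  obtain ⟨S, hS, hSfin⟩ := Group.fg_iff.1 ‹Group.FG G›
  have : Finite S := hSfin
  obtain ⟨n, ⟨eS⟩⟩ := Finite.exists_equiv_fin S
  obtain ⟨m, ⟨e⟩⟩ := Finite.exists_equiv_fin (G ⧸ N)
  let p : ConfigurationPair G n m :=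
    { gen := fun i ↦ eS.symm i
      closure_range_gen := by
        rw [show (fun i ↦ (eS.symm i : G)) = Subtype.val ∘ eS.symm from rfl,
          eS.symm.surjective.range_comp, Subtype.range_coe, hS]
      color := fun x ↦ e x
      color_surjective := e.surjective.comp QuotientGroup.mk_surjective }
  obtain ⟨p', hp'⟩ : p.twoSidedConfigurations ∈ twoSidedConfigurationSets H n m :=
    h n m ▸ ⟨p, rfl⟩
  let d : H → G ⧸ N := fun y ↦ e.symm (p'.color y)
  have hd : Function.Surjective d := e.symm.surjective.comp p'.color_surjective
  have hgen : ∀ i y, d (p'.gen i * y) = (p.gen i : G ⧸ N) * d y := fun i y ↦ by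
    -- the configuration of `y`
    let C : Fin (2 * n + 1) → Fin m := fun j ↦
      if hj₀ : j.val = 0 then p'.color y
      else if hj : j.val - 1 < n then p'.color (p'.gen ⟨j.val - 1, hj⟩ * y)
      else p'.color (y * p'.gen ⟨j.val - 1 - n, by have := j.2; omega⟩)
    have hC : C ∈ p'.twoSidedConfigurations := by
      refine ⟨y, by simp [ConfigurationPair.block, C], fun i ↦ ⟨?_, ?_⟩⟩
      · simp [ConfigurationPair.block, C]
      · have h1 : (i : ℕ) + 1 + n - 1 - n = i := by omega
        have h2 : ¬ (i : ℕ) + 1 + n - 1 < n := by omega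
        have h3 : ¬ (i : ℕ) + 1 + n = 0 := by omega
        simp only [ConfigurationPair.block, C, Set.mem_preimage, Set.mem_singleton_iff, h1, h2, h3,
          dite_false]
    rw [hp'] at hC
    obtain ⟨x, hx, hxi⟩ := hC
    have h0 : e x = p'.color y := by simpa [ConfigurationPair.block, C, p] using hx
    have h1 : e ((p.gen i : G ⧸ N) * x) = p'.color (p'.gen i * y) := by
      simpa [ConfigurationPair.block, C, p] using (hxi i).1
    simp only [d, ← h0, ← h1, Equiv.symm_apply_apply]
  have hall : ∀ a : H, ∃ q : G ⧸ N, ∀ y, d (a * y) = q * d y := fun a ↦ by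
    have ha : a ∈ Subgroup.closure (Set.range p'.gen) := by
      rw [p'.closure_range_gen]; exact Subgroup.mem_top a
    induction ha using Subgroup.closure_induction with
    | mem _ h =>
      obtain ⟨i, rfl⟩ := h
      exact ⟨_, hgen i⟩
    | one => exact ⟨1, by simp⟩
    | mul a b _ _ iha ihb =>
      obtain ⟨q, hq⟩ := iha
      obtain ⟨r, hr⟩ := ihb
      exact ⟨q * r, fun y ↦ by rw [mul_assoc, hq, hr, mul_assoc]⟩
    | inv a _ ih =>
      obtain ⟨q, hq⟩ := ih
      exact ⟨q⁻¹, fun y ↦ by rw [eq_inv_mul_iff_mul_eq, ← hq, mul_inv_cancel_left]⟩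
  have hmul : ∀ a y, d (a * y) = d a * (d 1)⁻¹ * d y := fun a y ↦ by
    obtain ⟨q, hq⟩ := hall a
    have := hq 1
    rw [mul_one] at this
    rw [hq, this, mul_inv_cancel_right]
  refine ⟨MonoidHom.mk' (fun a ↦ d a * (d 1)⁻¹) fun a b ↦ by rw [hmul, mul_assoc], fun q ↦ ?_⟩
  obtain ⟨a, ha⟩ := hd (q * d 1)
  exact ⟨a, by simp [ha]⟩

theorem TwoSidedConfigurationEquivalent.exists_mem_polycyclicQuotientSubgroups [Group.FG G]
    (h : TwoSidedConfigurationEquivalent G H) {N : Subgroup G}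
    [N.Normal]
    (hN : N ∈ polycyclicQuotientSubgroups G) [N.FiniteIndex] :
    ∃ f : H →* G ⧸ N, Function.Surjective f ∧ f.ker ∈ polycyclicQuotientSubgroups H ∧
      f.ker.index = N.index := by
  obtain ⟨f, hf⟩ := h.exists_surjective_quotient N
  refine ⟨f, hf, ?_, ?_⟩
  · have := map_mem_polycyclicQuotientSubgroups (QuotientGroup.mk'_surjective N) hN
    rw [QuotientGroup.map_mk'_self] at this
    exact comap_mem_polycyclicQuotientSubgroups f this
  · rw [Subgroup.index_ker, MonoidHom.range_eq_top.2 hf, Subgroup.card_top]; rfl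

theorem TwoSidedConfigurationEquivalent.exists_isLeast [Group.FG G]
    (h : TwoSidedConfigurationEquivalent G H) (hH : (polycyclicQuotientSubgroups H).Finite) :
    ∃ N₀ : Subgroup G, IsLeast (polycyclicQuotientSubgroups G) N₀ ∧ N₀.FiniteIndex := by
  obtain ⟨B, hB⟩ := exists_index_le_of_finite_polycyclicQuotientSubgroups H hH
  refine exists_least_polycyclicQuotientSubgroup (B := B) fun N hN _ ↦ ?_
  have : N.Normal := hN.1
  obtain ⟨f, -, hf, hfN⟩ := h.exists_mem_polycyclicQuotientSubgroups hN
  exact hfN ▸ hB _ hf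

theorem TwoSidedConfigurationEquivalent.finite [Group.FG G]
    (h : TwoSidedConfigurationEquivalent G H) (hH : (polycyclicQuotientSubgroups H).Finite) :
    (polycyclicQuotientSubgroups G).Finite := by
  obtain ⟨_, hN₀, _⟩ := h.exists_isLeast hH
  exact finite_polycyclicQuotientSubgroups_of_isLeast hN₀

/-- If `P(G)` is finite, the largest polycyclic quotients of `G` and `H` are finite, and each is a
quotient of the other. So they coincide. -/
theorem TwoSidedConfigurationEquivalent.exists_isLeast_ker [Group.FG G] [Group.FG H]
    (h : TwoSidedConfigurationEquivalent G H) (hG : (polycyclicQuotientSubgroups G).Finite) :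
    ∃ N₀ : Subgroup G, ∃ _ : N₀.Normal, IsLeast (polycyclicQuotientSubgroups G) N₀ ∧
      ∃ f : H →* G ⧸ N₀, Function.Surjective f ∧ IsLeast (polycyclicQuotientSubgroups H) f.ker := by
  obtain ⟨M₀, hM₀, _⟩ := h.symm.exists_isLeast hG
  obtain ⟨N₀, hN₀, _⟩ := h.exists_isLeast (finite_polycyclicQuotientSubgroups_of_isLeast hM₀)
  have : N₀.Normal := hN₀.1.1
  have : M₀.Normal := hM₀.1.1
  obtain ⟨f, hf, hfP, hfN⟩ := h.exists_mem_polycyclicQuotientSubgroups hN₀.1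
  obtain ⟨f', -, hfP', hfM⟩ := h.symm.exists_mem_polycyclicQuotientSubgroups hM₀.1
  have hfk : f.ker = M₀ := by
    by_contra hne
    have h1 := Subgroup.index_strictAnti ((hM₀.2 hfP).lt_of_ne' hne)
    have h2 := Subgroup.index_antitone (hN₀.2 hfP')
    omega
  exact ⟨N₀, ‹_›, hN₀, f, hf, hfk ▸ hM₀⟩

end Configurations

/-! ### The bijection in the finite case -/

section Correspondence

variable {G H Q : Type*} [Group G] [Group H] [Group Q]

/-- The correspondence theorem for two surjections `φ : G → Q` and `ψ : H → Q` whose kernels are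
the least elements of `P(G)` and `P(H)`: both sets are in bijection with the normal
subgroups of `Q`. -/
def polycyclicQuotientSubgroupsEquiv {φ : G →* Q} {ψ : H →* Q}
    (hφ : Function.Surjective φ) (hψ : Function.Surjective ψ)
    (hφP : IsLeast (polycyclicQuotientSubgroups G) φ.ker)
    (hψP : IsLeast (polycyclicQuotientSubgroups H) ψ.ker) :
    polycyclicQuotientSubgroups G ≃ polycyclicQuotientSubgroups H where
  toFun N := ⟨(N.1.map φ).comap ψ,
    comap_mem_polycyclicQuotientSubgroups ψ (map_mem_polycyclicQuotientSubgroups hφ N.2)⟩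
  invFun M := ⟨(M.1.map ψ).comap φ,
    comap_mem_polycyclicQuotientSubgroups φ (map_mem_polycyclicQuotientSubgroups hψ M.2)⟩
  left_inv N := Subtype.ext <| by
    simp [Subgroup.map_comap_eq_self_of_surjective hψ, Subgroup.comap_map_eq_self (hφP.2 N.2)]
  right_inv M := Subtype.ext <| by
    simp [Subgroup.map_comap_eq_self_of_surjective hφ, Subgroup.comap_map_eq_self (hψP.2 M.2)]

theorem nonempty_quotient_comap_map_mulEquiv {φ : G →* Q} {ψ : H →* Q}
    (hφ : Function.Surjective φ) (hψ : Function.Surjective ψ) (N : Subgroup G) [N.Normal]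
    [((N.map φ).comap ψ).Normal] (hN : φ.ker ≤ N) :
    Nonempty (G ⧸ N ≃* H ⧸ (N.map φ).comap ψ) := by
  have : (N.map φ).Normal := ‹N.Normal›.map φ hφ
  let α : G →* Q ⧸ N.map φ := (QuotientGroup.mk' _).comp φ
  let β : H →* Q ⧸ N.map φ := (QuotientGroup.mk' _).comp ψ
  have hα : α.ker = N := by
    rw [← MonoidHom.comap_ker, QuotientGroup.ker_mk', Subgroup.comap_map_eq_self hN]
  have hβ : β.ker = (N.map φ).comap ψ := by
    rw [← MonoidHom.comap_ker, QuotientGroup.ker_mk']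
  exact ⟨(QuotientGroup.quotientMulEquivOfEq hα.symm).trans <|
    (QuotientGroup.quotientKerEquivOfSurjective α
      ((QuotientGroup.mk'_surjective _).comp hφ)).trans <|
    (QuotientGroup.quotientKerEquivOfSurjective β
      ((QuotientGroup.mk'_surjective _).comp hψ)).symm.trans <|
    QuotientGroup.quotientMulEquivOfEq hβ⟩

end Correspondence

/-! ### Two-sided configuration equivalence and polycyclic quotients -/

theorem mainTheorem6 {G H : Type*} [Group G] [Group H] [Group.FG G] [Group.FG H]
    (hGH : TwoSidedConfigurationEquivalent G H) :
    Nonempty (polycyclicQuotientSubgroups G ≃ polycyclicQuotientSubgroups H) ∧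
    (Finite (polycyclicQuotientSubgroups G) →
      ∃ Ψ : polycyclicQuotientSubgroups G ≃ polycyclicQuotientSubgroups H,
        (∀ N M : polycyclicQuotientSubgroups G,
          ∃ h : (N : Subgroup G) ⊓ (M : Subgroup G) ∈ polycyclicQuotientSubgroups G,
            (Ψ ⟨(N : Subgroup G) ⊓ (M : Subgroup G), h⟩ : Subgroup H) =
              (Ψ N : Subgroup H) ⊓ (Ψ M : Subgroup H)) ∧
        (∀ N : polycyclicQuotientSubgroups G,
          Nonempty (G ⧸ (N : Subgroup G) ≃* H ⧸ (Ψ N : Subgroup H)))) := by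
  refine (and_iff_right_of_imp ?_).2 ?_
  · intro hfinite
    by_cases hG : (polycyclicQuotientSubgroups G).Finite
    · exact ⟨(hfinite hG).choose⟩
    · have hH : (polycyclicQuotientSubgroups H).Infinite := fun hH ↦ hG (hGH.finite hH)
      have := Set.Infinite.to_subtype hG
      have := hH.to_subtype
      have := (countable_polycyclicQuotientSubgroups (G := G)).to_subtype
      have := (countable_polycyclicQuotientSubgroups (G := H)).to_subtype
      obtain ⟨_⟩ := nonempty_denumerable (polycyclicQuotientSubgroups G)
      obtain ⟨_⟩ := nonempty_denumerable (polycyclicQuotientSubgroups H)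
      exact ⟨Denumerable.equiv₂ _ _⟩
  · intro hG
    obtain ⟨N₀, _, hN₀, ψ, hψ, hψP⟩ := hGH.exists_isLeast_ker hG
    have hφ := QuotientGroup.mk'_surjective N₀
    have hφP : IsLeast (polycyclicQuotientSubgroups G) (QuotientGroup.mk' N₀).ker := by
      rwa [QuotientGroup.ker_mk']
    let Ψ := polycyclicQuotientSubgroupsEquiv hφ hψ hφP hψP
    refine ⟨Ψ, fun N M ↦ ⟨inf_mem_polycyclicQuotientSubgroups N.2 M.2, ?_⟩, fun N ↦ ?_⟩
    · change ((N.1 ⊓ M.1).map _).comap ψ = (N.1.map _).comap ψ ⊓ (M.1.map _).comap ψ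
      rw [← Subgroup.comap_inf]
      congr 1
      -- images do not commute with intersections in general; here both subgroups contain `N₀`
      apply Subgroup.comap_injective hφ
      rw [Subgroup.comap_inf, Subgroup.comap_map_eq_self (hφP.2 N.2),
        Subgroup.comap_map_eq_self (hφP.2 M.2), Subgroup.comap_map_eq_self
          (hφP.2 (inf_mem_polycyclicQuotientSubgroups N.2 M.2))]
    · have : ((N.1.map (QuotientGroup.mk' N₀)).comap ψ).Normal := (Ψ N).2.1
      exact nonempty_quotient_comap_map_mulEquiv hφ hψ N.1 (hφP.2 N.2)
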